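/- Let $G\subseteq K_{m,n}$ be a connected bipartite graph without isolated vertices, with left vertices $1,\dots,m$ and right vertices $\bar 1,\dots,\bar n$, and let $I_i=\{j\in[n] : (i,\bar j)\in G\}$. For $I\subseteq[n]$ put $\Delta_I=\operatorname{conv}(e_j : j\in I)\subset\mathbb{R}^n$. For nonnegative integers $y_1,\dots,y_m$ and a tuple $J=(J_1,\dots,J_m)$ of nonempty subsets of $[n]$ put $\Pi_J=y_1\Delta_{J_1}+\cdots+y_m\Delta_{J_m}$, and let $$P_G=P_G(y_1,\dots,y_m)=\Pi_{(I_1,\dots,I_m)},\qquad P_G^-=P_G^-(y_1,\dots,y_m)=\{x\in\mathbb{R}^n : x+\Delta_{[n]}\subseteq P_G\}.$$ Let $d=\dim P_G$. A fine mixed cell of $P_G$ is a polytope $\Pi_J$, given together with a tuple $J$ with $\emptyset\ne J_i\subseteq I_i$ for all $i$, such that $\dim\Pi_J=d$, $\sum_i\dim(y_i\Delta_{J_i})=d$ and $\sum_i(|J_i|-1)=n-1$ (the last condition follows from the others if all $y_i$ are positive). Its left-degree vector is $(a_1,\dots,a_m)=(|J_1|-1,\dots,|J_m|-1)$. A fine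 mixed subdivision of $P_G$ is a finite collection of fine mixed cells, pairwise distinct as polytopes, whose union is $P_G$ and any two of which intersect in a common (possibly empty) face. Then, for every fine mixed subdivision of $P_G(y_1,\dots,y_m)$, the set $P_G^-(y_1,\dots,y_m)\cap\mathbb{Z}^n$ is finite and $$\#\bigl(P_G^-(y_1,\dots,y_m)\cap\mathbb{Z}^n\bigr)=\sum_{(a_1,\dots,a_m)}\ \prod_{i=1}^m\frac{(y_i)_{a_i}}{a_i!},$$ where $(y)_a=y(y+1)\cdots(y+a-1)$ for $a\ge1$, $(y)_0=1$, and the sum runs over the left-degree vectors $(a_1,\dots,a_m)$ of the cells of the subdivision, with one term for each cell. -/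

import Mathlib

open scoped Pointwise Nat

noncomputable section

namespace GenPerm

/-- The coordinate simplex `Δ_I = conv {e_i : i ∈ I}` in `ℝⁿ`. -/
def simplex {n : ℕ} (I : Finset (Fin n)) : Set (Fin n → ℝ) :=
  convexHull ℝ ((fun i => (Pi.single i 1 : Fin n → ℝ)) '' (I : Set (Fin n)))

/-- The Minkowski sum `Π_J = y_1 Δ_{J_1} + ⋯ + y_m Δ_{J_m}`. -/
def cell {m n : ℕ} (y : Fin m → ℕ) (J : Fin m → Finset (Fin n)) : Set (Fin n → ℝ) :=
  ∑ i, (y i : ℝ) • simplex (J i)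

open Classical in
/-- The set `I_i ⊆ [n]` of (right) neighbours of the left vertex `i`. -/
def nbrs {m n : ℕ} (G : SimpleGraph (Fin m ⊕ Fin n)) (i : Fin m) : Finset (Fin n) :=
  Finset.univ.filter fun j => G.Adj (Sum.inl i) (Sum.inr j)

/-- The generalized permutohedron `P_G(y_1, …, y_m) = y_1 Δ_{I_1} + ⋯ + y_m Δ_{I_m}`. -/
def genPerm {m n : ℕ} (G : SimpleGraph (Fin m ⊕ Fin n)) (y : Fin m → ℕ) : Set (Fin n → ℝ) :=
  cell y (nbrs G)

/-- The trimmed generalized permutohedron `P_G⁻ = {x ∈ ℝⁿ : x + Δ_[n] ⊆ P_G}`. -/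
def trimmed {m n : ℕ} (G : SimpleGraph (Fin m ⊕ Fin n)) (y : Fin m → ℕ) : Set (Fin n → ℝ) :=
  {x | ∀ p ∈ simplex (Finset.univ : Finset (Fin n)), x + p ∈ genPerm G y}

/-- The lattice points of a subset of `ℝⁿ`. -/
def latticePoints {n : ℕ} (P : Set (Fin n → ℝ)) : Set (Fin n → ℤ) :=
  {x | (fun j => (x j : ℝ)) ∈ P}

/-- The dimension of a nonempty polytope: the dimension of its affine span. -/
def polyDim {n : ℕ} (P : Set (Fin n → ℝ)) : ℕ :=
  Module.finrank ℝ (vectorSpan ℝ P)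

/-- The left degree vector `(d_1 - 1, …, d_m - 1)` of the bipartite graph in which the left
vertex `i` has neighbour set `J i`. -/
def leftDegree {m n : ℕ} (J : Fin m → Finset (Fin n)) (i : Fin m) : ℕ :=
  (J i).card - 1

/-- `J = (J_1, …, J_m)` describes a fine mixed cell `Π_J = B_1 + ⋯ + B_m` of `P_G(y)`, where
`B_i = y_i Δ_{J_i}` is the convex hull of a nonempty set of vertices of `y_i Δ_{I_i}`
(each such `B_i` is a simplex). -/
structure IsFineMixedCell {m n : ℕ} (G : SimpleGraph (Fin m ⊕ Fin n)) (y : Fin m → ℕ)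
    (J : Fin m → Finset (Fin n)) : Prop where
  nonempty : ∀ i, (J i).Nonempty
  subset : ∀ i, J i ⊆ nbrs G i
  /-- a Minkowski cell has the dimension of the whole sum -/
  dim_eq : polyDim (cell y J) = polyDim (genPerm G y)
  /-- fineness: `∑ dim B_i = d` -/
  fine : ∑ i, polyDim ((y i : ℝ) • simplex (J i)) = polyDim (genPerm G y)
  /-- The graph of `J` has the `m + n - 1` edges of a spanning tree of `G`. For connected `G` and
  positive `y` this follows from `fine`. If `y_i = 0`, then `B_i = {0}` for every choice of `J_i`,
  and this condition fixes the total degree of the labels that the polytopes do not determine. -/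
  edges : (∑ i, leftDegree J i) + 1 = n

/-- `C` is (the set of labels of the cells of) a fine mixed subdivision of `P_G(y)`: its cells are
pairwise distinct fine mixed cells, their union is `P_G(y)`, and any two of them intersect in a
common (possibly empty) face. Faces of polytopes are exposed faces. -/
structure IsFineMixedSubdivision {m n : ℕ} (G : SimpleGraph (Fin m ⊕ Fin n)) (y : Fin m → ℕ)
    (C : Finset (Fin m → Finset (Fin n))) : Prop where
  isCell : ∀ J ∈ C, IsFineMixedCell G y J
  distinct : Set.InjOn (cell y) (C : Set (Fin m → Finset (Fin n)))
  cover : (⋃ J ∈ C, cell y J) = genPerm G y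
  inter_face : ∀ J ∈ C, ∀ K ∈ C,
    IsExposed ℝ (cell y J) (cell y J ∩ cell y K) ∧ IsExposed ℝ (cell y K) (cell y J ∩ cell y K)

end GenPerm

end

/-! Suppose first that `P_G` has dimension `n - 1`. Then the bipartite graph of each cell label `J`
is a spanning tree: full dimension makes it connected, and it has `m + n - 1` edges. A point of
`Π_J` is the vector of column sums of a nonnegative matrix supported on `J` with row sums `y`, and
on a tree the row and column sums determine every entry, by an integral formula: delete the edge and
sum over one side of the resulting cut (`exists_cut`). The key device is a matrix `shift q`, linear
in `q` and read off from these cuts. For `q ∈ Δ_[n]` it is supported on `J`, has entries in `[0,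
1]`, row sums `a_i = |J_i| - 1` and column sums `1 - q_j`. Adding it to a matrix representing `x +
q` gives row sums `y_i + a_i` and column sums `x_j + 1`; these are integers, so all entries are. For
the barycentre `q` the shift is positive on the edges in rows with `|J_i| > 1`, so there the integer
entries are at least 1. Conversely, subtracting `shift q` from such an integer matrix leaves a
nonnegative one for every `q`. Hence `x + q ∈ Π_J` for the barycentre alone already gives `x + Δ_[n]
⊆ Π_J`, and these `x` correspond bijectively to integer matrices whose rows are chosen
independently; each row contributes one factor of the product. Since the cells cover `P_G`, every
lattice point of the trimmed polytope arises from some cell. It arises from only one, because an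
exposed face of `Π_J` containing the barycentre of `x + Δ_[n] ⊆ Π_J` is all of `Π_J`. If `P_G` has
smaller dimension, both sides vanish. -/

noncomputable section

namespace GenPerm

/-! ### Counting admissible rows -/

/-- The number of weak compositions of `k` indexed by a set with `a + 1` elements. -/
theorem card_piAntidiag {ι : Type*} [DecidableEq ι] (a : ℕ) :
    ∀ (s : Finset ι) (k : ℕ), s.card = a + 1 → (s.piAntidiag k).card = (k + a).choose a := by
  induction a with
  | zero =>
    intro s k hs
    obtain ⟨i, rfl⟩ := Finset.card_eq_one.1 (by simpa using hs)
    rw [Nat.choose_zero_right, Finset.card_eq_one]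
    refine ⟨Pi.single i k, ?_⟩
    ext f
    simp only [Finset.mem_piAntidiag, Finset.sum_singleton, Finset.mem_singleton]
    constructor
    · rintro ⟨h1, h2⟩
      ext j
      by_cases hj : j = i
      · subst hj; simpa using h1
      · rw [Pi.single_eq_of_ne hj]
        by_contra h
        exact hj (h2 j h)
    · rintro rfl
      refine ⟨by simp, fun j hj => ?_⟩
      by_contra h
      exact hj (Pi.single_eq_of_ne h _)
  | succ a ih =>
    intro s k hs
    obtain ⟨i, t, hi, rfl, ht⟩ := Finset.card_eq_succ.1 hs
    rw [← Finset.cons_eq_insert _ _ hi, Finset.piAntidiag_cons, Finset.card_disjiUnion]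
    simp only [Finset.card_map]
    rw [Finset.sum_congr rfl (fun p _ => ih t p.2 ht),
      Finset.Nat.sum_antidiagonal_eq_sum_range_succ_mk]
    have h := Finset.sum_range_reflect (fun l => (l + a).choose a) (k + 1)
    rw [Nat.sum_range_add_choose] at h
    simpa [add_assoc] using h

/-- The admissible rows: vectors supported on `I` with entry sum `y + |I| - 1` whose entries on `I`
are positive, unless `I` has only one element. -/
def rowSet {n : ℕ} (I : Finset (Fin n)) (y : ℕ) : Finset (Fin n → ℕ) :=
  {v ∈ I.piAntidiag (y + (I.card - 1)) | I.card = 1 ∨ ∀ j ∈ I, 1 ≤ v j}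

/-- Both sides are `(y + a - 1).choose a` with `a = |I| - 1`. For `y = 0 < a` both vanish: `a + 1`
positive entries cannot sum to `a`. -/
theorem card_rowSet {n : ℕ} {I : Finset (Fin n)} (hI : I.Nonempty) (y : ℕ) :
    ((rowSet I y).card : ℚ) = (y.ascFactorial (I.card - 1) : ℚ) / ((I.card - 1)! : ℚ) := by
  obtain ⟨a, ha⟩ : ∃ a, I.card = a + 1 := ⟨I.card - 1, by have := hI.card_pos; omega⟩
  rw [Nat.ascFactorial_eq_factorial_mul_choose', Nat.cast_mul,
    mul_div_cancel_left₀ _ (by exact_mod_cast Nat.factorial_ne_zero _), Nat.cast_inj, rowSet, ha,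
    Nat.add_sub_cancel]
  rcases Nat.eq_zero_or_pos a with rfl | ha0
  · rw [Finset.filter_true_of_mem (by simp), card_piAntidiag 0 I _ ha]
    simp
  have h1 : ¬ (a + 1 = 1) := by omega
  simp only [h1, false_or]
  have hsum1 : ∀ v : Fin n → ℕ, (∀ j ∈ I, 1 ≤ v j) →
      ∑ j ∈ I, (v j - 1) + (a + 1) = ∑ j ∈ I, v j := by
    intro v hv
    rw [← ha, Finset.card_eq_sum_ones, ← Finset.sum_add_distrib]
    exact Finset.sum_congr rfl fun j hj => Nat.sub_add_cancel (hv j hj)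
  rcases Nat.eq_zero_or_pos y with rfl | hy
  · rw [Nat.choose_eq_zero_of_lt (by omega), Finset.card_eq_zero, Finset.filter_eq_empty_iff]
    intro v hv hpos
    have := hsum1 v hpos
    rw [(Finset.mem_piAntidiag.1 hv).1] at this
    omega
  -- Subtracting 1 from each of the `a + 1` entries on `I` leaves a weak composition of `y - 1`.
  · rw [show y + a - 1 = (y - 1) + a by omega, ← card_piAntidiag a I (y - 1) ha]
    refine Finset.card_nbij' (fun v j => v j - 1) (fun c j => c j + if j ∈ I then 1 else 0)
      ?_ ?_ ?_ ?_
    · intro v hv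
      simp only [Finset.coe_filter, Set.mem_ofPred_eq, Finset.mem_piAntidiag] at hv
      simp only [Finset.mem_coe, Finset.mem_piAntidiag]
      refine ⟨?_, fun j hj => hv.1.2 j (by omega)⟩
      have := hsum1 v hv.2
      rw [hv.1.1] at this
      omega
    · intro c hc
      simp only [Finset.mem_coe, Finset.mem_piAntidiag] at hc
      simp only [Finset.coe_filter, Set.mem_ofPred_eq, Finset.mem_piAntidiag]
      refine ⟨⟨?_, fun j hj => ?_⟩, fun j hj => by simp [hj]⟩
      · rw [Finset.sum_add_distrib, hc.1, Finset.sum_ite_mem]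
        simp [ha]; omega
      · by_contra h
        exact hj (by simpa [h] using fun h' => h (hc.2 j h'))
    · intro v hv
      simp only [Finset.coe_filter, Set.mem_ofPred_eq, Finset.mem_piAntidiag] at hv
      ext j
      by_cases hj : j ∈ I
      · have := hv.2 j hj
        simp only [hj, if_true]; omega
      · have : v j = 0 := by
          by_contra h
          exact hj (hv.1.2 j h)
        simp [hj, this]
    · intro c hc
      simp only [Finset.mem_coe, Finset.mem_piAntidiag] at hc
      ext j
      by_cases hj : j ∈ I
      · simp [hj]
      · have : c j = 0 := by
          by_contra h
          exact hj (hc.2 j h)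
        simp [hj, this]

variable {m n : ℕ}

/-! ### Simplices and cells as matrices; dimensions -/

/-- Membership in a dilated coordinate simplex. -/
theorem mem_smul_simplex {I : Finset (Fin n)} (hI : I.Nonempty) (c : ℕ) (z : Fin n → ℝ) :
    z ∈ (c : ℝ) • simplex I ↔ (∀ j, 0 ≤ z j) ∧ (∀ j, j ∉ I → z j = 0) ∧ ∑ j, z j = c := by
  have key : ∀ u : Fin n → ℝ, u ∈ simplex I ↔
      (∀ j, 0 ≤ u j) ∧ (∀ j, j ∉ I → u j = 0) ∧ ∑ j, u j = 1 := by
    intro u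
    constructor
    · intro hu
      have hconv : Convex ℝ {u : Fin n → ℝ |
          (∀ j, 0 ≤ u j) ∧ (∀ j, j ∉ I → u j = 0) ∧ ∑ j, u j = 1} := by
        rintro u ⟨h1, h2, h3⟩ v ⟨h4, h5, h6⟩ a b ha hb hab
        refine ⟨fun j => ?_, fun j hj => ?_, ?_⟩
        · have := h1 j
          have := h4 j
          simp only [Pi.add_apply, Pi.smul_apply, smul_eq_mul]
          positivity
        · simp [h2 j hj, h5 j hj]
        · simp [Finset.sum_add_distrib, ← Finset.mul_sum, h3, h6, hab]
      refine convexHull_min ?_ hconv hu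
      rintro _ ⟨i, hi, rfl⟩
      refine ⟨fun j => ?_, fun j hj => ?_, by simp⟩
      · by_cases h : j = i
        · subst h; simp
        · simp [h]
      · exact Pi.single_eq_of_ne (by rintro rfl; exact hj hi) _
    · rintro ⟨h1, h2, h3⟩
      have hs : ∑ j ∈ I, u j = 1 := by
        rw [← h3]
        exact Finset.sum_subset (Finset.subset_univ _) fun j _ hj => h2 j hj
      have hu : u = ∑ j ∈ I, u j • (Pi.single j 1 : Fin n → ℝ) := by
        ext k
        simp only [Finset.sum_apply, Pi.smul_apply, Pi.single_apply, smul_eq_mul, mul_ite, mul_one,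
          mul_zero, Finset.sum_ite_eq]
        split_ifs with h
        · rfl
        · exact h2 k h
      rw [hu]
      exact (convex_convexHull ℝ _).sum_mem (fun j _ => h1 j) hs
        fun j hj => subset_convexHull ℝ _ ⟨j, hj, rfl⟩
  rw [Set.mem_smul_set]
  constructor
  · rintro ⟨u, hu, rfl⟩
    obtain ⟨h1, h2, h3⟩ := (key u).1 hu
    refine ⟨fun j => ?_, fun j hj => by simp [h2 j hj], by simp [← Finset.mul_sum, h3]⟩
    have := h1 j
    simp only [Pi.smul_apply, smul_eq_mul]
    positivity
  · rintro ⟨h1, h2, h3⟩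
    rcases Nat.eq_zero_or_pos c with rfl | hc
    · obtain ⟨i, hi⟩ := hI
      refine ⟨Pi.single i 1, subset_convexHull ℝ _ ⟨i, hi, rfl⟩, ?_⟩
      ext j
      have := (Finset.sum_eq_zero_iff_of_nonneg fun j _ => h1 j).1 (by simpa using h3) j
        (Finset.mem_univ _)
      simp [this]
    · have hc' : (c : ℝ) ≠ 0 := by positivity
      refine ⟨(c : ℝ)⁻¹ • z, (key _).2 ⟨fun j => ?_, fun j hj => by simp [h2 j hj], ?_⟩,
        smul_inv_smul₀ hc' z⟩
      · have := h1 j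
        simp only [Pi.smul_apply, smul_eq_mul]
        positivity
      · simp [← Finset.mul_sum, h3, hc']

theorem mem_simplex_univ (hn : 0 < n) (z : Fin n → ℝ) :
    z ∈ simplex (Finset.univ : Finset (Fin n)) ↔ (∀ j, 0 ≤ z j) ∧ ∑ j, z j = 1 := by
  have : (Finset.univ : Finset (Fin n)).Nonempty := ⟨⟨0, hn⟩, Finset.mem_univ _⟩
  have h := mem_smul_simplex this 1 z
  simpa using h

/-- A point of `Π_J` is the vector of column sums of a nonnegative matrix supported on `J` with row
sums `y`. -/
theorem mem_cell {J : Fin m → Finset (Fin n)} (hJ : ∀ i, (J i).Nonempty) (y : Fin m → ℕ)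
    (z : Fin n → ℝ) :
    z ∈ cell y J ↔ ∃ w : Fin m → Fin n → ℝ, (∀ i j, 0 ≤ w i j) ∧ (∀ i j, j ∉ J i → w i j = 0) ∧
      (∀ i, ∑ j, w i j = y i) ∧ ∀ j, ∑ i, w i j = z j := by
  rw [cell, Set.mem_fintype_sum]
  constructor
  · rintro ⟨w, hw, rfl⟩
    have h := fun i => (mem_smul_simplex (hJ i) (y i) (w i)).1 (hw i)
    exact ⟨w, fun i => (h i).1, fun i => (h i).2.1, fun i => (h i).2.2, fun j => by simp⟩
  · rintro ⟨w, h1, h2, h3, h4⟩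
    exact ⟨w, fun i => (mem_smul_simplex (hJ i) (y i) (w i)).2 ⟨h1 i, h2 i, h3 i⟩,
      by ext j; simp [h4]⟩

/-- The hyperplane of vectors with coordinate sum zero. -/
def sumZero (n : ℕ) : Submodule ℝ (Fin n → ℝ) :=
  LinearMap.ker (∑ j, LinearMap.proj j : (Fin n → ℝ) →ₗ[ℝ] ℝ)

theorem mem_sumZero {z : Fin n → ℝ} : z ∈ sumZero n ↔ ∑ j, z j = 0 := by
  simp [sumZero]

theorem finrank_sumZero (hn : 0 < n) : Module.finrank ℝ (sumZero n) = n - 1 := by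
  have hsurj : Function.Surjective (∑ j, LinearMap.proj j : (Fin n → ℝ) →ₗ[ℝ] ℝ) := by
    intro c
    exact ⟨Pi.single ⟨0, hn⟩ c, by simp⟩
  have h := LinearMap.finrank_range_add_finrank_ker
    (∑ j, LinearMap.proj j : (Fin n → ℝ) →ₗ[ℝ] ℝ)
  rw [LinearMap.range_eq_top.2 hsurj, finrank_top] at h
  simp only [Module.finrank_self, Module.finrank_fin_fun] at h
  rw [sumZero]
  omega

/-- The column sums of the matrices supported on `J` all of whose row sums vanish. -/
def flowSpan (J : Fin m → Finset (Fin n)) : Submodule ℝ (Fin n → ℝ) where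
  carrier := {z | ∃ F : Fin m → Fin n → ℝ, (∀ i j, j ∉ J i → F i j = 0) ∧
    (∀ i, ∑ j, F i j = 0) ∧ ∀ j, ∑ i, F i j = z j}
  zero_mem' := ⟨0, by simp, by simp, by simp⟩
  add_mem' := by
    rintro a b ⟨F, h1, h2, h3⟩ ⟨F', h4, h5, h6⟩
    refine ⟨F + F', fun i j hj => by simp [h1 i j hj, h4 i j hj], fun i => ?_, fun j => ?_⟩
    · simp [Finset.sum_add_distrib, h2, h5]
    · simp [Finset.sum_add_distrib, h3, h6]
  smul_mem' := by
    rintro c a ⟨F, h1, h2, h3⟩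
    refine ⟨c • F, fun i j hj => by simp [h1 i j hj], fun i => ?_, fun j => ?_⟩
    · simp [← Finset.mul_sum, h2]
    · simp [← Finset.mul_sum, h3]

theorem flowSpan_le_sumZero (J : Fin m → Finset (Fin n)) : flowSpan J ≤ sumZero n := by
  rintro z ⟨F, -, h2, h3⟩
  rw [mem_sumZero, ← Finset.sum_congr rfl fun j _ => h3 j, Finset.sum_comm]
  simp [h2]

theorem vectorSpan_cell_le {J : Fin m → Finset (Fin n)} (hJ : ∀ i, (J i).Nonempty)
    (y : Fin m → ℕ) : vectorSpan ℝ (cell y J) ≤ flowSpan J := by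
  rw [vectorSpan_def, Submodule.span_le]
  rintro _ ⟨p, hp, q, hq, rfl⟩
  obtain ⟨w, -, h2, h3, h4⟩ := (mem_cell hJ y p).1 hp
  obtain ⟨w', -, h2', h3', h4'⟩ := (mem_cell hJ y q).1 hq
  refine ⟨w - w', fun i j hj => by simp [h2 i j hj, h2' i j hj], fun i => ?_, fun j => ?_⟩
  · simp [h3, h3']
  · simp [h4, h4']

theorem polyDim_smul_simplex {I : Finset (Fin n)} (hI : I.Nonempty) (c : ℕ)
    (hc : c = 0 → I.card = 1) : polyDim ((c : ℝ) • simplex I) = I.card - 1 := by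
  rcases Nat.eq_zero_or_pos c with rfl | hpos
  · have h0 : ((0 : ℕ) : ℝ) • simplex I = {0} := by
      rw [Nat.cast_zero, Set.zero_smul_set]
      · rfl
      · exact (hI.to_set.image _).convexHull
    rw [h0, polyDim, vectorSpan_singleton, finrank_bot, hc rfl]
  · have hc' : (c : ℝ) ≠ 0 := by positivity
    have hmap : (c : ℝ) • simplex I =
        (LinearEquiv.smulOfNeZero ℝ (Fin n → ℝ) (c : ℝ) hc').toLinearMap.toAffineMap ''
          simplex I := rfl
    have hind : AffineIndependent ℝ (fun i : I => (Pi.single (i : Fin n) 1 : Fin n → ℝ)) := by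
      have : LinearIndependent ℝ (fun i : Fin n => (Pi.single i 1 : Fin n → ℝ)) := by
        convert (Pi.basisFun ℝ (Fin n)).linearIndependent using 1
        ext i
        simp
      exact (this.comp _ Subtype.val_injective).affineIndependent
    have hfr := hind.finrank_vectorSpan (n := I.card - 1)
      (by rw [Fintype.card_coe]; have := hI.card_pos; omega)
    have hrange : Set.range (fun i : I => (Pi.single (i : Fin n) 1 : Fin n → ℝ)) =
        (fun i => (Pi.single i 1 : Fin n → ℝ)) '' (I : Set (Fin n)) := by
      ext z; simp
    rw [polyDim, hmap, ← AffineMap.map_vectorSpan]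
    have hspan : vectorSpan ℝ (simplex I) =
        vectorSpan ℝ ((fun i => (Pi.single i 1 : Fin n → ℝ)) '' (I : Set (Fin n))) := by
      rw [simplex, ← direction_affineSpan, affineSpan_convexHull, direction_affineSpan]
    rw [hspan, ← hrange, ← hfr]
    exact LinearEquiv.finrank_map_eq _ _

/-! ### The spanning tree of a cell and its cuts -/

/-- The bipartite graph in which the left vertex `i` has neighbour set `J i`. -/
def labelGraph (J : Fin m → Finset (Fin n)) : SimpleGraph (Fin m ⊕ Fin n) :=
  SimpleGraph.fromRel fun a b => ∃ i j, j ∈ J i ∧ a = Sum.inl i ∧ b = Sum.inr j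

theorem labelGraph_adj {J : Fin m → Finset (Fin n)} {i : Fin m} {j : Fin n} :
    (labelGraph J).Adj (Sum.inl i) (Sum.inr j) ↔ j ∈ J i := by
  simp [labelGraph]

theorem labelGraph_isBipartiteWith (J : Fin m → Finset (Fin n)) :
    (labelGraph J).IsBipartiteWith
      ((Finset.univ.map Function.Embedding.inl : Finset (Fin m ⊕ Fin n)) : Set (Fin m ⊕ Fin n))
      ((Finset.univ.map Function.Embedding.inr : Finset (Fin m ⊕ Fin n)) : Set (Fin m ⊕ Fin n)) := by
  constructor
  · rw [Set.disjoint_left]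
    rintro (a | a) <;> simp
  · rintro (a | a) (b | b) h <;> simp_all [labelGraph]

open Classical in
theorem card_edgeFinset_labelGraph (J : Fin m → Finset (Fin n)) :
    (labelGraph J).edgeFinset.card = ∑ i, (J i).card := by
  rw [← SimpleGraph.isBipartiteWith_sum_degrees_eq_card_edges (labelGraph_isBipartiteWith J),
    Finset.sum_map]
  refine Finset.sum_congr rfl fun i _ => ?_
  have h : (labelGraph J).neighborFinset (Function.Embedding.inl i) =
      (J i).map Function.Embedding.inr := by
    ext (a | a)
    · rw [SimpleGraph.mem_neighborFinset]
      simp [labelGraph]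
    · simp [labelGraph_adj]
  rw [← SimpleGraph.card_neighborFinset_eq_degree, h, Finset.card_map]

/-- Pairing column sums minus row sums with the indicator of a vertex set. -/
theorem sum_col_sub_sum_row (L : Finset (Fin m)) (R : Finset (Fin n)) (w : Fin m → Fin n → ℝ) :
    ∑ k ∈ R, ∑ l, w l k - ∑ l ∈ L, ∑ k, w l k =
      ∑ l, ∑ k, w l k * ((if k ∈ R then 1 else 0) - (if l ∈ L then 1 else 0)) := by
  rw [Finset.sum_comm]
  simp only [mul_sub, mul_ite, mul_one, mul_zero, Finset.sum_sub_distrib, Finset.sum_ite_mem,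
    Finset.univ_inter]
  congr 1
  rw [← Finset.sum_filter_add_sum_filter_not Finset.univ (· ∈ L)]
  rw [Finset.sum_congr rfl (g := fun x => ∑ k, w x k) (by simp +contextual)]
  rw [Finset.sum_eq_zero (s := Finset.univ.filter (· ∉ L)) (by simp +contextual)]
  simp

/-- The column sums over a connected component minus its row sums vanish for every matrix supported
on `J`. A matrix realising `e_k - e_l` with zero row sums therefore cannot exist when `k` and `l`
lie in different components. -/
theorem labelGraph_connected {J : Fin m → Finset (Fin n)} (hJ : ∀ i, (J i).Nonempty) (hn : 0 < n)
    (hspan : flowSpan J = sumZero n) : (labelGraph J).Connected := by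
  classical
  set T := labelGraph J with hT
  have hright : ∀ k l : Fin n, T.Reachable (Sum.inr k) (Sum.inr l) := by
    intro k l
    by_contra hkl
    have hmem : (Pi.single k 1 - Pi.single l 1 : Fin n → ℝ) ∈ flowSpan J := by
      rw [hspan, mem_sumZero]
      simp
    obtain ⟨F, h1, h2, h3⟩ := hmem
    have h := sum_col_sub_sum_row
      (Finset.univ.filter fun i => T.Reachable (Sum.inr k) (Sum.inl i))
      (Finset.univ.filter fun j => T.Reachable (Sum.inr k) (Sum.inr j)) F
    rw [Finset.sum_congr rfl fun j _ => h3 j, Finset.sum_congr rfl fun i _ => h2 i] at h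
    rw [Finset.sum_eq_zero (s := Finset.univ) (fun i _ => Finset.sum_eq_zero fun j _ => ?_)] at h
    · simp [Pi.single_apply, hkl] at h
    · by_cases hj : j ∈ J i
      · have hadj : T.Adj (Sum.inl i) (Sum.inr j) := labelGraph_adj.2 hj
        have : T.Reachable (Sum.inr k) (Sum.inl i) ↔ T.Reachable (Sum.inr k) (Sum.inr j) :=
          ⟨fun h => h.trans hadj.reachable, fun h => h.trans hadj.symm.reachable⟩
        simp [this]
      · simp [h1 i j hj]
  have hroot : ∀ v, T.Reachable v (Sum.inr ⟨0, hn⟩) := by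
    rintro (i | j)
    · obtain ⟨j, hj⟩ := hJ i
      have hadj : T.Adj (Sum.inl i) (Sum.inr j) := labelGraph_adj.2 hj
      exact hadj.reachable.trans (hright _ _)
    · exact hright _ _
  have : Nonempty (Fin m ⊕ Fin n) := ⟨Sum.inr ⟨0, hn⟩⟩
  exact ⟨fun u v => (hroot u).trans (hroot v).symm⟩

theorem labelGraph_isTree {J : Fin m → Finset (Fin n)} (hJ : ∀ i, (J i).Nonempty) (hn : 0 < n)
    (hedges : (∑ i, leftDegree J i) + 1 = n) (hspan : flowSpan J = sumZero n) :
    (labelGraph J).IsTree := by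
  classical
  rw [SimpleGraph.isTree_iff_connected_and_card]
  refine ⟨labelGraph_connected hJ hn hspan, ?_⟩
  rw [Nat.card_eq_fintype_card, ← SimpleGraph.edgeFinset_card, card_edgeFinset_labelGraph]
  have : ∑ i, (J i).card = ∑ i, leftDegree J i + m := by
    rw [Finset.sum_congr rfl (g := fun i => leftDegree J i + 1)
      (fun i _ => by have := (hJ i).card_pos; rw [leftDegree]; omega), Finset.sum_add_distrib]
    simp
  simp
  omega

/-- Deleting the edge `(i, j)` of a spanning tree yields a cut which expresses the `(i, j)` entry of
a matrix supported on the tree through its row and column sums. -/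
theorem exists_cut {J : Fin m → Finset (Fin n)} (hT : (labelGraph J).IsTree) {i : Fin m} {j : Fin n}
    (hj : j ∈ J i) :
    ∃ (L : Finset (Fin m)) (R : Finset (Fin n)), j ∈ R ∧ (∀ k ∈ J i, k ≠ j → k ∉ R) ∧
      ∀ w : Fin m → Fin n → ℝ, (∀ i j, j ∉ J i → w i j = 0) →
        w i j = ∑ k ∈ R, ∑ l, w l k - ∑ l ∈ L, ∑ k, w l k := by
  classical
  have hadj : (labelGraph J).Adj (Sum.inl i) (Sum.inr j) := labelGraph_adj.2 hj
  have hbr := SimpleGraph.isAcyclic_iff_forall_adj_isBridge.1 hT.isAcyclic hadj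
  rw [SimpleGraph.isBridge_iff] at hbr
  set T' := (labelGraph J).deleteEdges {s(Sum.inl i, Sum.inr j)} with hT'
  have hadj' : ∀ l k, k ∈ J l → ¬ (l = i ∧ k = j) → T'.Adj (Sum.inl l) (Sum.inr k) := by
    intro l k hk hne
    rw [hT', SimpleGraph.deleteEdges_adj]
    refine ⟨labelGraph_adj.2 hk, fun h => hne ?_⟩
    simpa using h
  refine ⟨Finset.univ.filter fun l => T'.Reachable (Sum.inr j) (Sum.inl l),
    Finset.univ.filter fun k => T'.Reachable (Sum.inr j) (Sum.inr k), by simp, ?_, ?_⟩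
  · intro k hk hne hmem
    simp only [Finset.mem_filter, Finset.mem_univ, true_and] at hmem
    exact hbr (((hadj' i k hk (by simp [hne])).reachable).trans hmem.symm)
  · intro w hw
    -- The deleted edge is the only one joining the two sides, so every other term cancels.
    rw [sum_col_sub_sum_row, Finset.sum_eq_single i, Finset.sum_eq_single j]
    · have hbr' : ¬ T'.Reachable (Sum.inr j) (Sum.inl i) := fun h => hbr h.symm
      simp [hbr']
    · intro k _ hk
      by_cases hkJ : k ∈ J i
      · have h := hadj' i k hkJ (by simp [hk])
        have : T'.Reachable (Sum.inr j) (Sum.inl i) ↔ T'.Reachable (Sum.inr j) (Sum.inr k) :=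
          ⟨fun h' => h'.trans h.reachable, fun h' => h'.trans h.symm.reachable⟩
        simp [this]
      · simp [hw i k hkJ]
    · simp
    · intro l _ hl
      refine Finset.sum_eq_zero fun k _ => ?_
      by_cases hkJ : k ∈ J l
      · have h := hadj' l k hkJ (by simp [hl])
        have : T'.Reachable (Sum.inr j) (Sum.inl l) ↔ T'.Reachable (Sum.inr j) (Sum.inr k) :=
          ⟨fun h' => h'.trans h.reachable, fun h' => h'.trans h.symm.reachable⟩
        simp [this]
      · simp [hw l k hkJ]
    · simp

/-- A system of cuts for the label `J`, one for each edge of its graph. The last two fields say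
that the sets `R i j`, `j ∈ J i`, partition the right vertices, and that for right vertices `k ≠ j`
exactly one neighbour `i` of `j` satisfies `k ∉ R i j`. -/
structure CutSystem (J : Fin m → Finset (Fin n)) where
  L : Fin m → Fin n → Finset (Fin m)
  R : Fin m → Fin n → Finset (Fin n)
  cut : ∀ w : Fin m → Fin n → ℝ, (∀ i j, j ∉ J i → w i j = 0) → ∀ i, ∀ j ∈ J i,
    w i j = ∑ k ∈ R i j, ∑ l, w l k - ∑ l ∈ L i j, ∑ k, w l k
  notMem : ∀ i, ∀ j ∈ J i, ∀ k ∈ J i, k ≠ j → k ∉ R i j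
  sum_row : ∀ k i, (∑ j, if j ∈ J i ∧ k ∈ R i j then (1 : ℝ) else 0) = 1
  sum_col : ∀ k j, (∑ i, if j ∈ J i ∧ k ∉ R i j then (1 : ℝ) else 0) = if j = k then 0 else 1

/-- The partition identities come from evaluating the cut formula on a matrix that realises `e_k -
e_l` with zero row sums: its entries are differences of cut indicators for `k` and `l`. -/
theorem nonempty_cutSystem {J : Fin m → Finset (Fin n)} (hJ : ∀ i, (J i).Nonempty) (hn : 0 < n)
    (hedges : (∑ i, leftDegree J i) + 1 = n) (hspan : flowSpan J = sumZero n) :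
    Nonempty (CutSystem J) := by
  classical
  have hT := labelGraph_isTree hJ hn hedges hspan
  have H : ∀ i j, ∃ (L : Finset (Fin m)) (R : Finset (Fin n)), j ∈ J i → (j ∈ R ∧
      (∀ k ∈ J i, k ≠ j → k ∉ R) ∧ ∀ w : Fin m → Fin n → ℝ, (∀ i j, j ∉ J i → w i j = 0) →
        w i j = ∑ k ∈ R, ∑ l, w l k - ∑ l ∈ L, ∑ k, w l k) := by
    intro i j
    by_cases hj : j ∈ J i
    · obtain ⟨L, R, h⟩ := exists_cut hT hj
      exact ⟨L, R, fun _ => h⟩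
    · exact ⟨∅, ∅, fun h => absurd h hj⟩
  choose L R H using H
  have hflow : ∀ k l : Fin n, ∃ F : Fin m → Fin n → ℝ, (∀ i, ∑ j, F i j = 0) ∧
      (∀ j, ∑ i, F i j = (if j = k then 1 else 0) - if j = l then 1 else 0) ∧
      ∀ i j, F i j = (if j ∈ J i ∧ k ∈ R i j then 1 else 0) -
        if j ∈ J i ∧ l ∈ R i j then 1 else 0 := by
    intro k l
    have hmem : (Pi.single k 1 - Pi.single l 1 : Fin n → ℝ) ∈ flowSpan J := by
      rw [hspan, mem_sumZero]
      simp
    obtain ⟨F, h1, h2, h3⟩ := hmem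
    refine ⟨F, h2, fun j => by rw [h3]; simp [Pi.single_apply], fun i j => ?_⟩
    by_cases hj : j ∈ J i
    · rw [(H i j hj).2.2 F h1, Finset.sum_congr rfl fun j _ => h3 j,
        Finset.sum_congr rfl fun i _ => h2 i]
      simp [Pi.single_apply, hj]
    · simp [h1 i j hj, hj]
  refine ⟨⟨L, R, fun w hw i j hj => (H i j hj).2.2 w hw,
    fun i j hj => (H i j hj).2.1, fun k i => ?_, fun k j => ?_⟩⟩
  -- The row count does not depend on `k`; for a neighbour `l` of `i` only `R i l` contains `l`.
  · obtain ⟨l, hl⟩ := hJ i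
    obtain ⟨F, h1, -, h3⟩ := hflow k l
    have h := h1 i
    simp only [h3, Finset.sum_sub_distrib] at h
    rw [sub_eq_zero.1 h, Finset.sum_eq_single l]
    · simp [hl, (H i l hl).1]
    · intro j _ hjl
      rw [if_neg]
      rintro ⟨hj, hlR⟩
      exact (H i j hj).2.1 l hl (Ne.symm hjl) hlR
    · simp
  -- With `l = j` the second indicator is 1 on every edge at `j`, so the column sum of `F` counts
  -- the `i` with `k ∉ R i j`, up to sign.
  · obtain ⟨F, -, h2, h3⟩ := hflow k j
    have h := h2 j
    simp only [h3, Finset.sum_sub_distrib, if_true] at h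
    have e : ∀ i, (if j ∈ J i ∧ k ∉ R i j then (1 : ℝ) else 0) =
        (if j ∈ J i ∧ j ∈ R i j then 1 else 0) - if j ∈ J i ∧ k ∈ R i j then 1 else 0 := by
      intro i
      by_cases hj : j ∈ J i
      · by_cases hk : k ∈ R i j <;> simp [hj, hk, (H i j hj).1]
      · simp [hj]
    simp only [e, Finset.sum_sub_distrib]
    by_cases hjk : j = k <;> simp only [hjk, if_true, if_false] at h ⊢ <;> linarith

/-- The matrix, depending linearly on `q`, whose `(i, j)` entry is the total weight of the right
vertices outside `R i j`. -/
def CutSystem.shift {J : Fin m → Finset (Fin n)} (S : CutSystem J) (q : Fin n → ℝ) (i : Fin m)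
    (j : Fin n) : ℝ :=
  ∑ k, q k * if j ∈ J i ∧ k ∉ S.R i j then 1 else 0

namespace CutSystem
variable {J : Fin m → Finset (Fin n)} (S : CutSystem J) {q : Fin n → ℝ}

theorem shift_of_notMem {i : Fin m} {j : Fin n} (hj : j ∉ J i) : S.shift q i j = 0 := by
  simp [shift, hj]

theorem shift_nonneg (hq : ∀ k, 0 ≤ q k) (i : Fin m) (j : Fin n) : 0 ≤ S.shift q i j :=
  Finset.sum_nonneg fun k _ => mul_nonneg (hq k) (by split_ifs <;> norm_num)

theorem shift_le_one (hq : ∀ k, 0 ≤ q k) (hs : ∑ k, q k = 1) (i : Fin m) (j : Fin n) :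
    S.shift q i j ≤ 1 := by
  rw [← hs]
  exact Finset.sum_le_sum fun k _ => mul_le_of_le_one_right (hq k) (by split_ifs <;> norm_num)

theorem sum_shift_row (hJ : ∀ i, (J i).Nonempty) (hs : ∑ k, q k = 1) (i : Fin m) :
    ∑ j, S.shift q i j = leftDegree J i := by
  have h : ∀ k, (∑ j, if j ∈ J i ∧ k ∉ S.R i j then (1 : ℝ) else 0) = leftDegree J i := by
    intro k
    have e : ∀ j, (if j ∈ J i ∧ k ∉ S.R i j then (1 : ℝ) else 0) =
        (if j ∈ J i then 1 else 0) - if j ∈ J i ∧ k ∈ S.R i j then 1 else 0 := by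
      intro j
      by_cases hj : j ∈ J i <;> by_cases hk : k ∈ S.R i j <;> simp [hj, hk]
    simp only [e, Finset.sum_sub_distrib, S.sum_row]
    rw [leftDegree, Nat.cast_sub (hJ i).card_pos]
    simp
  simp only [shift]
  rw [Finset.sum_comm]
  simp only [← Finset.mul_sum, h]
  rw [← Finset.sum_mul, hs, one_mul]

theorem sum_shift_col (hs : ∑ k, q k = 1) (j : Fin n) : ∑ i, S.shift q i j = 1 - q j := by
  simp only [shift]
  rw [Finset.sum_comm]
  simp only [← Finset.mul_sum, S.sum_col]
  have e : ∀ k, q k * (if j = k then (0 : ℝ) else 1) = q k - if j = k then q k else 0 := by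
    intro k
    split_ifs <;> simp
  simp only [e, Finset.sum_sub_distrib, hs]
  simp

theorem shift_eq_zero (hJ : ∀ i, (J i).Nonempty) (hq : ∀ k, 0 ≤ q k) (hs : ∑ k, q k = 1)
    {i : Fin m} (hi : (J i).card = 1) (j : Fin n) : S.shift q i j = 0 := by
  have h := S.sum_shift_row hJ hs i
  rw [leftDegree, hi, Nat.sub_self, Nat.cast_zero,
    Finset.sum_eq_zero_iff_of_nonneg fun j _ => S.shift_nonneg hq i j] at h
  exact h j (Finset.mem_univ _)

theorem shift_pos (hq : ∀ k, 0 < q k) {i : Fin m} (hi : (J i).card ≠ 1) {j : Fin n}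
    (hj : j ∈ J i) : 0 < S.shift q i j := by
  obtain ⟨k, hk, hkj⟩ : ∃ k ∈ J i, k ≠ j :=
    Finset.exists_mem_ne (by have := Finset.card_pos.2 ⟨j, hj⟩; omega) j
  refine Finset.sum_pos' (fun l _ => mul_nonneg (hq l).le (by split_ifs <;> norm_num))
    ⟨k, Finset.mem_univ _, ?_⟩
  simpa [hj, S.notMem i j hj k hk hkj] using hq k

end CutSystem

/-! ### Lattice points of a single cell -/

/-- The matrices all of whose rows are admissible. -/
def matrixSet (J : Fin m → Finset (Fin n)) (y : Fin m → ℕ) : Finset (Fin m → Fin n → ℕ) :=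
  Fintype.piFinset fun i => rowSet (J i) (y i)

theorem mem_matrixSet {J : Fin m → Finset (Fin n)} {y : Fin m → ℕ} {v : Fin m → Fin n → ℕ} :
    v ∈ matrixSet J y ↔ ∀ i, ∑ j, v i j = y i + leftDegree J i ∧ (∀ j, j ∉ J i → v i j = 0) ∧
      ((J i).card = 1 ∨ ∀ j ∈ J i, 1 ≤ v i j) := by
  simp only [matrixSet, Fintype.mem_piFinset, rowSet, Finset.mem_filter, Finset.mem_piAntidiag,
    leftDegree, and_assoc]
  refine forall_congr' fun i => ?_
  have h : (∀ j, v i j ≠ 0 → j ∈ J i) ↔ ∀ j, j ∉ J i → v i j = 0 :=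
    forall_congr' fun j => not_imp_comm
  rw [h]
  refine and_congr_left fun h => ?_
  rw [Finset.sum_subset (Finset.subset_univ _) fun j _ hj => h.1 j hj]

/-- The lattice points `x` with `x + Δ_[n] ⊆ Π_J`. -/
def cellLatticePoints (y : Fin m → ℕ) (J : Fin m → Finset (Fin n)) : Set (Fin n → ℤ) :=
  {x | ∀ q ∈ simplex (Finset.univ : Finset (Fin n)), (fun j => (x j : ℝ)) + q ∈ cell y J}

/-- The barycentre of `Δ_[n]`. -/
def barycentre (n : ℕ) : Fin n → ℝ := fun _ => (n : ℝ)⁻¹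

theorem sum_barycentre (hn : 0 < n) : ∑ k, barycentre n k = 1 := by
  have : (n : ℝ) ≠ 0 := by positivity
  simp [barycentre, this]

theorem barycentre_pos (hn : 0 < n) (k : Fin n) : 0 < barycentre n k := by
  simp only [barycentre]
  positivity

theorem barycentre_mem (hn : 0 < n) :
    barycentre n ∈ simplex (Finset.univ : Finset (Fin n)) :=
  (mem_simplex_univ hn _).2 ⟨fun k => (barycentre_pos hn k).le, sum_barycentre hn⟩

/-- The lattice point attached to a matrix. -/
def colSum (v : Fin m → Fin n → ℕ) (j : Fin n) : ℤ := ∑ i, (v i j : ℤ) - 1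

theorem colSum_mem_cellLatticePoints {J : Fin m → Finset (Fin n)} (hJ : ∀ i, (J i).Nonempty)
    (hn : 0 < n) (S : CutSystem J) (y : Fin m → ℕ) {v : Fin m → Fin n → ℕ}
    (hv : v ∈ matrixSet J y) : colSum v ∈ cellLatticePoints y J := by
  rw [mem_matrixSet] at hv
  intro q hq
  obtain ⟨hq0, hq1⟩ := (mem_simplex_univ hn q).1 hq
  refine (mem_cell hJ y _).2 ⟨fun i j => v i j - S.shift q i j, fun i j => ?_, fun i j hj => ?_,
    fun i => ?_, fun j => ?_⟩
  · rw [sub_nonneg]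
    rcases (hv i).2.2 with h | h
    · rw [S.shift_eq_zero hJ hq0 hq1 h]
      positivity
    · by_cases hj : j ∈ J i
      · exact (S.shift_le_one hq0 hq1 i j).trans (by exact_mod_cast h j hj)
      · rw [S.shift_of_notMem hj]
        positivity
  · simp [(hv i).2.1 j hj, S.shift_of_notMem hj]
  · rw [Finset.sum_sub_distrib, S.sum_shift_row hJ hq1, ← Nat.cast_sum, (hv i).1]
    simp
  · rw [Finset.sum_sub_distrib, S.sum_shift_col hq1]
    simp only [Pi.add_apply, colSum]
    push_cast
    ring

/-- Only the one point `x + q`, with `q` the barycentre, is required in the cell; adding `shift q`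
to its matrix gives the integer matrix. -/
theorem exists_matrix_of_barycentre {J : Fin m → Finset (Fin n)} (hJ : ∀ i, (J i).Nonempty)
    (hn : 0 < n) (S : CutSystem J) (y : Fin m → ℕ) {x : Fin n → ℤ}
    (hx : (fun j => (x j : ℝ)) + barycentre n ∈ cell y J) :
    ∃ v ∈ matrixSet J y, colSum v = x := by
  obtain ⟨w, h1, h2, h3, h4⟩ := (mem_cell hJ y _).1 hx
  have hq := sum_barycentre hn
  have hq0 := fun k => (barycentre_pos hn k).le
  set u : Fin m → Fin n → ℝ := fun i j => w i j + S.shift (barycentre n) i j with hu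
  have hu0 : ∀ i j, 0 ≤ u i j := fun i j => add_nonneg (h1 i j) (S.shift_nonneg hq0 i j)
  have husupp : ∀ i j, j ∉ J i → u i j = 0 := fun i j hj => by
    simp [hu, h2 i j hj, S.shift_of_notMem hj]
  have hurow : ∀ i, ∑ j, u i j = ((y i + leftDegree J i : ℤ) : ℝ) := fun i => by
    simp [hu, Finset.sum_add_distrib, h3, S.sum_shift_row hJ hq]
  have hucol : ∀ j, ∑ i, u i j = ((x j + 1 : ℤ) : ℝ) := fun j => by
    simp [hu, Finset.sum_add_distrib, h4, S.sum_shift_col hq]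
  have hint : ∀ i j, ∃ N : ℕ, u i j = N := by
    intro i j
    by_cases hj : j ∈ J i
    -- The cut formula writes the entry as a difference of sums of integers.
    · have h := S.cut u husupp i j hj
      rw [Finset.sum_congr rfl fun j _ => hucol j, Finset.sum_congr rfl fun i _ => hurow i,
        ← Int.cast_sum, ← Int.cast_sum, ← Int.cast_sub] at h
      obtain ⟨N, hN⟩ := Int.eq_ofNat_of_zero_le (Int.cast_nonneg_iff.1 (h ▸ hu0 i j))
      exact ⟨N, by rw [h, hN]; simp⟩
    · exact ⟨0, by simp [husupp i j hj]⟩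
  choose v hv using hint
  refine ⟨v, mem_matrixSet.2 fun i => ⟨?_, fun j hj => ?_, ?_⟩, ?_⟩
  · have h := hurow i
    simp only [hv] at h
    exact_mod_cast h
  · have h := husupp i j hj
    rw [hv] at h
    exact_mod_cast h
  · by_cases hi : (J i).card = 1
    · exact Or.inl hi
    · refine Or.inr fun j hj => ?_
      have h : 0 < u i j :=
        add_pos_of_nonneg_of_pos (h1 i j) (S.shift_pos (barycentre_pos hn) hi hj)
      rw [hv] at h
      exact_mod_cast h
  · ext j
    have h := hucol j
    simp only [hv] at h
    have h' : ∑ i, (v i j : ℤ) = x j + 1 := by exact_mod_cast h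
    rw [colSum, h', add_sub_cancel_right]

/-- The difference of two such matrices has zero row and column sums, so the cut formula makes each
entry zero. -/
theorem injOn_colSum {J : Fin m → Finset (Fin n)} (S : CutSystem J) (y : Fin m → ℕ) :
    Set.InjOn (colSum : (Fin m → Fin n → ℕ) → Fin n → ℤ) (matrixSet J y) := by
  intro v hv v' hv' hvv
  have hv := mem_matrixSet.1 hv
  have hv' := mem_matrixSet.1 hv'
  ext i j
  by_cases hj : j ∈ J i
  · have hd := S.cut (fun i j => (v i j : ℝ) - v' i j)
      (fun i j hj => by simp [(hv i).2.1 j hj, (hv' i).2.1 j hj]) i j hj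
    rw [Finset.sum_eq_zero, Finset.sum_eq_zero, sub_zero, sub_eq_zero] at hd
    · exact_mod_cast hd
    · intro l _
      rw [Finset.sum_sub_distrib, ← Nat.cast_sum, ← Nat.cast_sum, (hv l).1, (hv' l).1, sub_self]
    · intro k _
      have h := congrFun hvv k
      simp only [colSum, sub_left_inj] at h
      rw [Finset.sum_sub_distrib, sub_eq_zero]
      exact_mod_cast h
  · rw [(hv i).2.1 j hj, (hv' i).2.1 j hj]

/-- An exposed face of `Π_J` containing `x + p`, where `x + Δ_[n] ⊆ Π_J` and `p` is the barycentre
of `Δ_[n]`, is all of `Π_J`. -/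
theorem eq_cell_of_isExposed {J : Fin m → Finset (Fin n)} (hJ : ∀ i, (J i).Nonempty) (hn : 0 < n)
    {y : Fin m → ℕ} {x : Fin n → ℤ} (hx : x ∈ cellLatticePoints y J) {B : Set (Fin n → ℝ)}
    (hB : IsExposed ℝ (cell y J) B) (hxB : (fun j => (x j : ℝ)) + barycentre n ∈ B) :
    B = cell y J := by
  obtain ⟨l, rfl⟩ := hB ⟨_, hxB⟩
  refine Set.Subset.antisymm (fun z hz => hz.1) fun z hz => ⟨hz, fun z' hz' => ?_⟩
  -- The functional `l` exposing the face is maximal at the barycentre of `x + Δ_[n]`, hence equal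
  -- at all vertices, since the barycentre is their average with positive weights. So `l` is a
  -- multiple of the coordinate sum, which is constant on `Π_J`.
  have hvert : ∀ k, l (Pi.single k 1) ≤ l (barycentre n) := by
    intro k
    have h := hxB.2 _ (hx (Pi.single k 1) ((mem_simplex_univ hn _).2
      ⟨fun j => by by_cases h : j = k <;> simp [h], by simp⟩))
    simpa using h
  have hexp : ∀ z : Fin n → ℝ, l z = ∑ k, z k * l (Pi.single k 1) := by
    intro z
    conv_lhs => rw [← Finset.univ_sum_single z]
    rw [map_sum]
    refine Finset.sum_congr rfl fun k _ => ?_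
    rw [← smul_eq_mul, ← map_smul]
    congr 1
    ext j
    simp [Pi.single_apply]
  have heq : ∀ k, l (Pi.single k 1) = l (barycentre n) := by
    have h : ∑ k, barycentre n k * (l (barycentre n) - l (Pi.single k 1)) = 0 := by
      simp only [mul_sub, Finset.sum_sub_distrib]
      rw [← hexp, ← Finset.sum_mul, sum_barycentre hn, one_mul, sub_self]
    rw [Finset.sum_eq_zero_iff_of_nonneg fun k _ =>
      mul_nonneg (barycentre_pos hn k).le (sub_nonneg.2 (hvert k))] at h
    intro k
    rcases mul_eq_zero.1 (h k (Finset.mem_univ _)) with h | h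
    · exact absurd h (barycentre_pos hn k).ne'
    · linarith
  have hsum : ∀ z ∈ cell y J, l z = (∑ i, (y i : ℝ)) * l (barycentre n) := by
    intro z hz
    obtain ⟨w, -, -, h3, h4⟩ := (mem_cell hJ y z).1 hz
    rw [hexp, Finset.sum_congr rfl fun k _ => by rw [heq k], ← Finset.sum_mul,
      ← Finset.sum_congr rfl fun k _ => h4 k, Finset.sum_comm, Finset.sum_congr rfl fun i _ => h3 i]
  rw [hsum z hz, hsum z' hz']

/-! ### From cells to the whole polytope -/

theorem nbrs_nonempty {G : SimpleGraph (Fin m ⊕ Fin n)}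
    (hbip : G ≤ completeBipartiteGraph (Fin m) (Fin n)) (hiso : ∀ v, ∃ w, G.Adj v w) (i : Fin m) :
    (nbrs G i).Nonempty := by
  obtain ⟨w | j, hw⟩ := hiso (Sum.inl i)
  · simpa using hbip hw
  · exact ⟨j, by simpa [nbrs] using hw⟩

/-- If `P_G` is not of full dimension, its trimmed polytope is empty. -/
theorem polyDim_eq_of_mem_trimmed {G : SimpleGraph (Fin m ⊕ Fin n)} {y : Fin m → ℕ}
    (hne : ∀ i, (nbrs G i).Nonempty) (hn : 0 < n) {x : Fin n → ℝ} (hx : x ∈ trimmed G y) :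
    polyDim (genPerm G y) = n - 1 := by
  have hle : vectorSpan ℝ (genPerm G y) ≤ sumZero n :=
    (vectorSpan_cell_le hne y).trans (flowSpan_le_sumZero _)
  suffices h : sumZero n ≤ vectorSpan ℝ (genPerm G y) by
    rw [polyDim, le_antisymm hle h, finrank_sumZero hn]
  have hvert : ∀ k, x + Pi.single k 1 ∈ genPerm G y := fun k =>
    hx _ (subset_convexHull ℝ _ ⟨k, by simp, rfl⟩)
  intro z hz
  -- The base vertex cancels because the coordinates of `z` sum to zero.
  have hz' : z = ∑ k, z k • ((x + Pi.single k 1) - (x + Pi.single ⟨0, hn⟩ 1)) := by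
    simp only [add_sub_add_left_eq_sub, smul_sub, Finset.sum_sub_distrib, ← Finset.sum_smul,
      mem_sumZero.1 hz, zero_smul, sub_zero]
    ext j
    simp [Pi.single_apply]
  rw [hz']
  exact Submodule.sum_mem _ fun k _ => Submodule.smul_mem _ _
    (vsub_mem_vectorSpan ℝ (hvert k) (hvert _))

/-- A fine mixed cell of a polytope which is not of full dimension contributes nothing. -/
theorem prod_eq_zero_of_polyDim_ne {G : SimpleGraph (Fin m ⊕ Fin n)} {y : Fin m → ℕ}
    {J : Fin m → Finset (Fin n)} (hJ : IsFineMixedCell G y J)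
    (hd : polyDim (genPerm G y) ≠ n - 1) :
    ∏ i, ((y i).ascFactorial (leftDegree J i) : ℚ) / ((leftDegree J i)! : ℚ) = 0 := by
  by_contra h
  refine hd ?_
  -- A nonzero product excludes `y i = 0` with `|J_i| > 1`, as the rising factorial would start at
  -- 0. Then each summand has dimension `|J_i| - 1`, and fineness gives total dimension `n - 1`.
  have hc : ∀ i, y i = 0 → (J i).card = 1 := by
    intro i hi
    have h := Finset.prod_ne_zero_iff.1 h i (Finset.mem_univ _)
    by_contra hcard
    refine h ?_
    obtain ⟨a, ha⟩ : ∃ a, leftDegree J i = a + 1 :=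
      ⟨(J i).card - 2, by have := (hJ.nonempty i).card_pos; rw [leftDegree]; omega⟩
    rw [hi, ha, Nat.zero_ascFactorial]
    simp
  rw [← hJ.fine, Finset.sum_congr rfl fun i _ => polyDim_smul_simplex (hJ.nonempty i) (y i) (hc i)]
  have := hJ.edges
  simp only [leftDegree] at this
  omega

/-- The directions of the cell already have dimension `n - 1` and lie in `flowSpan J ≤ sumZero n`,
so these two spaces coincide. -/
theorem IsFineMixedCell.nonempty_cutSystem {G : SimpleGraph (Fin m ⊕ Fin n)} {y : Fin m → ℕ}
    {J : Fin m → Finset (Fin n)} (hJ : IsFineMixedCell G y J) (hn : 0 < n)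
    (hd : polyDim (genPerm G y) = n - 1) : Nonempty (CutSystem J) := by
  refine GenPerm.nonempty_cutSystem hJ.nonempty hn hJ.edges ?_
  refine Submodule.eq_of_le_of_finrank_le (flowSpan_le_sumZero J) ?_
  rw [finrank_sumZero hn, ← hd, ← hJ.dim_eq]
  exact Submodule.finrank_mono (vectorSpan_cell_le hJ.nonempty y)

open Classical in
theorem latticePoints_trimmed_eq {G : SimpleGraph (Fin m ⊕ Fin n)} {y : Fin m → ℕ}
    {C : Finset (Fin m → Finset (Fin n))} (hC : IsFineMixedSubdivision G y C) (hn : 0 < n)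
    (hd : polyDim (genPerm G y) = n - 1) :
    latticePoints (trimmed G y) = C.biUnion fun J => (matrixSet J y).image colSum := by
  ext x
  simp only [Finset.coe_biUnion, Set.mem_iUnion, Finset.mem_coe, Finset.mem_image, exists_prop]
  constructor
  · intro hx
    have hb : (fun j => (x j : ℝ)) + barycentre n ∈ genPerm G y := hx _ (barycentre_mem hn)
    rw [← hC.cover] at hb
    simp only [Set.mem_iUnion, exists_prop] at hb
    obtain ⟨J, hJC, hb⟩ := hb
    obtain ⟨S⟩ := (hC.isCell J hJC).nonempty_cutSystem hn hd
    exact ⟨J, hJC, exists_matrix_of_barycentre (hC.isCell J hJC).nonempty hn S y hb⟩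
  · rintro ⟨J, hJC, v, hv, rfl⟩ q hq
    obtain ⟨S⟩ := (hC.isCell J hJC).nonempty_cutSystem hn hd
    rw [← hC.cover]
    simp only [Set.mem_iUnion, exists_prop]
    exact ⟨J, hJC, colSum_mem_cellLatticePoints (hC.isCell J hJC).nonempty hn S y hv q hq⟩

-- A common `x` puts its translated barycentre in `cell y J ∩ cell y K`, an exposed face of both
-- cells; it then equals both, contradicting distinctness.
open Classical in
theorem pairwiseDisjoint_image_colSum {G : SimpleGraph (Fin m ⊕ Fin n)} {y : Fin m → ℕ}
    {C : Finset (Fin m → Finset (Fin n))} (hC : IsFineMixedSubdivision G y C) (hn : 0 < n)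
    (hd : polyDim (genPerm G y) = n - 1) :
    (C : Set (Fin m → Finset (Fin n))).PairwiseDisjoint
      fun J => (matrixSet J y).image (colSum : (Fin m → Fin n → ℕ) → Fin n → ℤ) := by
  intro J hJ K hK hne
  refine Finset.disjoint_left.2 fun x hxJ hxK => hne (hC.distinct hJ hK ?_)
  have hmem : ∀ J ∈ C, x ∈ (matrixSet J y).image colSum → x ∈ cellLatticePoints y J := by
    intro J hJ hx
    obtain ⟨v, hv, rfl⟩ := Finset.mem_image.1 hx
    obtain ⟨S⟩ := (hC.isCell J hJ).nonempty_cutSystem hn hd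
    exact colSum_mem_cellLatticePoints (hC.isCell J hJ).nonempty hn S y hv
  have hJx := hmem J hJ hxJ
  have hKx := hmem K hK hxK
  have hb := (⟨hJx _ (barycentre_mem hn), hKx _ (barycentre_mem hn)⟩ :
    (fun j => (x j : ℝ)) + barycentre n ∈ cell y J ∩ cell y K)
  rw [← eq_cell_of_isExposed (hC.isCell J hJ).nonempty hn hJx (hC.inter_face J hJ K hK).1 hb]
  exact eq_cell_of_isExposed (hC.isCell K hK).nonempty hn hKx (hC.inter_face J hJ K hK).2 hb

end GenPerm

end

theorem corollary4p1 {m n : ℕ} (G : SimpleGraph (Fin m ⊕ Fin n))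
    (hbip : G ≤ completeBipartiteGraph (Fin m) (Fin n))
    (hiso : ∀ v, ∃ w, G.Adj v w)
    (hconn : G.Connected)
    (y : Fin m → ℕ)
    (C : Finset (Fin m → Finset (Fin n)))
    (hC : GenPerm.IsFineMixedSubdivision G y C) :
    (GenPerm.latticePoints (GenPerm.trimmed G y)).Finite ∧
      ((GenPerm.latticePoints (GenPerm.trimmed G y)).ncard : ℚ) =
        ∑ J ∈ C, ∏ i, ((y i).ascFactorial (GenPerm.leftDegree J i) : ℚ) /
          ((GenPerm.leftDegree J i)! : ℚ) := by
  classical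
  have hne := GenPerm.nbrs_nonempty hbip hiso
  have hn : 0 < n := by
    obtain ⟨i | j⟩ := hconn.nonempty
    · exact (hne i).choose.pos
    · exact j.pos
  by_cases hd : GenPerm.polyDim (GenPerm.genPerm G y) = n - 1
  · rw [GenPerm.latticePoints_trimmed_eq hC hn hd]
    refine ⟨Finset.finite_toSet _, ?_⟩
    rw [Set.ncard_coe_finset,
      Finset.card_biUnion (GenPerm.pairwiseDisjoint_image_colSum hC hn hd), Nat.cast_sum]
    refine Finset.sum_congr rfl fun J hJ => ?_
    obtain ⟨S⟩ := (hC.isCell J hJ).nonempty_cutSystem hn hd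
    rw [Finset.card_image_of_injOn (GenPerm.injOn_colSum S y), GenPerm.matrixSet,
      Fintype.card_piFinset, Nat.cast_prod]
    exact Finset.prod_congr rfl fun i _ =>
      GenPerm.card_rowSet ((hC.isCell J hJ).nonempty i) (y i)
  · have hempty : GenPerm.latticePoints (GenPerm.trimmed G y) = ∅ :=
      Set.eq_empty_of_forall_notMem fun x hx =>
        hd (GenPerm.polyDim_eq_of_mem_trimmed hne hn hx)
    rw [hempty]
    refine ⟨Set.finite_empty, ?_⟩
    rw [Set.ncard_empty, Nat.cast_zero,
      Finset.sum_eq_zero fun J hJ => GenPerm.prod_eq_zero_of_polyDim_ne (hC.isCell J hJ) hd]
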